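/- Let $d\ge 0$ be an integer and let $X_d$ be the unital associative real algebra generated by $e_1,\dots,e_{d+2}$ subject to the relations $e_j^2=-1$ for $1\le j\le d+1$, $e_je_k=-e_ke_j$ for $1\le j\neq k\le d+1$, $e_{d+2}^2=0$, and $e_{d+2}e_j=e_je_{d+2}$ for $1\le j\le d+1$. Let $i:\mathbb R^d\to X_d$ be the linear map sending the standard basis to $e_1,\dots,e_d$. Let $\alpha$ be the automorphism of $X_d$ with $\alpha(e_j)=-e_j$ for $1\le j\le d+1$ and $\alpha(e_{d+2})=e_{d+2}$, let $t$ be the anti-automorphism of $X_d$ fixing every $e_j$ ($1\le j\le d+2$), and put $\overline{x}=\alpha(t(x))$ and $N(x)=x\overline{x}$. Let $Z_d^0\subset X_d$ be the linear subspace with basis consisting of the products (in increasing order, the empty product being $1$) of an even number of distinct elements of $\{e_1,\dots,e_d,\,e_{d+1}e_{d+2}\}$, where $e_{d+1}e_{d+2}$ counts as a single element, and let $H_0\subset Z_d^0$ be the hyperplane of elements whose coordinate at the basis element $1$ is zero. Let $$\mathrm{Spun}(d)=\{z\in Z_d^0:\ N(z)=1 \text{ and for every } v\in\mathbb R^d \text{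 there is } w\in\mathbb R^d \text{ with } z(e_{d+2}i(v)+e_{d+1})\overline{z}=e_{d+2}i(w)+e_{d+1}\}.$$ For $x\in \mathrm{Spun}(d)$ and $v\in\mathbb R^d$, let $v^x\in\mathbb R^d$ be the point with $x(e_{d+2}i(v)+e_{d+1})\overline{x}=e_{d+2}i(v^x)+e_{d+1}$, and for $a,p\in\mathbb R^d$ let $T_{ap}=\{x\in\mathrm{Spun}(d):\ a^x=p\}$. Let $a,b,p,q\in\mathbb R^d$ with $a\ne b$, and suppose that $T_{ap}\cap T_{bq}\neq\emptyset$. Then $T_{ap}\cap T_{bq}\subseteq H_0$ if and only if $a-b=q-p$. -/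

import Mathlib

namespace SpunGroup

/-- The defining relations of the algebra `X_d` on the generators `e_1, …, e_{d+2}`.  The generators
are indexed by `Fin (d + 2)`: `Fin.castSucc j` with `j : Fin (d + 1)` stands for
`e_1, …, e_{d+1}`, and `Fin.last (d + 1)` stands for the nilpotent generator `e_{d+2}`. -/
inductive Rel (d : ℕ) :
    FreeAlgebra ℝ (Fin (d + 2)) → FreeAlgebra ℝ (Fin (d + 2)) → Prop
  | anticomm (j k : Fin (d + 1)) (hjk : j ≠ k) :
      Rel d (FreeAlgebra.ι ℝ j.castSucc * FreeAlgebra.ι ℝ k.castSucc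
        + FreeAlgebra.ι ℝ k.castSucc * FreeAlgebra.ι ℝ j.castSucc) 0
  | sq (j : Fin (d + 1)) :
      Rel d (FreeAlgebra.ι ℝ j.castSucc * FreeAlgebra.ι ℝ j.castSucc + 1) 0
  | sq_last :
      Rel d (FreeAlgebra.ι ℝ (Fin.last (d + 1)) * FreeAlgebra.ι ℝ (Fin.last (d + 1))) 0
  | comm_last (j : Fin (d + 1)) :
      Rel d (FreeAlgebra.ι ℝ (Fin.last (d + 1)) * FreeAlgebra.ι ℝ j.castSucc
        - FreeAlgebra.ι ℝ j.castSucc * FreeAlgebra.ι ℝ (Fin.last (d + 1))) 0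

/-- The real algebra `X_d`: generated by `e_1, …, e_{d+2}`, where `e_1, …, e_{d+1}` square to `-1`
and pairwise anticommute, `e_{d+2}` squares to `0` and commutes with all generators. -/
def X (d : ℕ) : Type := RingQuot (Rel d)

noncomputable section

instance (d : ℕ) : Ring (X d) := inferInstanceAs (Ring (RingQuot (Rel d)))

instance (d : ℕ) : Algebra ℝ (X d) := inferInstanceAs (Algebra ℝ (RingQuot (Rel d)))

/-- The quotient map from the free algebra onto `X_d`. -/
def mk (d : ℕ) : FreeAlgebra ℝ (Fin (d + 2)) →ₐ[ℝ] X d := RingQuot.mkAlgHom ℝ (Rel d)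

theorem mk_rel (d : ℕ) {x y : FreeAlgebra ℝ (Fin (d + 2))} (h : Rel d x y) :
    mk d x = mk d y := RingQuot.mkAlgHom_rel ℝ h

/-- The universal property of `X_d`. -/
def lift (d : ℕ) {A : Type*} [Ring A] [Algebra ℝ A] (g : FreeAlgebra ℝ (Fin (d + 2)) →ₐ[ℝ] A)
    (hg : ∀ ⦃x y⦄, Rel d x y → g x = g y) : X d →ₐ[ℝ] A :=
  RingQuot.liftAlgHom ℝ ⟨g, hg⟩

theorem lift_mk (d : ℕ) {A : Type*} [Ring A] [Algebra ℝ A]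
    (g : FreeAlgebra ℝ (Fin (d + 2)) →ₐ[ℝ] A) (hg : ∀ ⦃x y⦄, Rel d x y → g x = g y)
    (x : FreeAlgebra ℝ (Fin (d + 2))) : lift d g hg (mk d x) = g x :=
  RingQuot.liftAlgHom_mkAlgHom_apply ℝ g hg x

/-- The generators `e_1, …, e_{d+2}` of `X_d`. -/
def e (d : ℕ) (j : Fin (d + 2)) : X d :=
  mk d (FreeAlgebra.ι ℝ j)

/-- The generator `e_{d+1}`. -/
def eRot (d : ℕ) : X d := e d (Fin.last d).castSucc

/-- The generator `e_{d+2}`, with square zero. -/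
def eNil (d : ℕ) : X d := e d (Fin.last (d + 1))

theorem e_anticomm (d : ℕ) (j k : Fin (d + 1)) (hjk : j ≠ k) :
    e d j.castSucc * e d k.castSucc + e d k.castSucc * e d j.castSucc = 0 := by
  simpa [e] using mk_rel d (Rel.anticomm j k hjk)

theorem e_sq (d : ℕ) (j : Fin (d + 1)) : e d j.castSucc * e d j.castSucc + 1 = 0 := by
  simpa [e] using mk_rel d (Rel.sq j)

theorem e_sq_last (d : ℕ) : e d (Fin.last (d + 1)) * e d (Fin.last (d + 1)) = 0 := by
  simpa [e] using mk_rel d (Rel.sq_last (d := d))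

theorem e_comm_last (d : ℕ) (j : Fin (d + 1)) :
    e d (Fin.last (d + 1)) * e d j.castSucc - e d j.castSucc * e d (Fin.last (d + 1)) = 0 := by
  simpa [e] using mk_rel d (Rel.comm_last j)

/-- The automorphism `α` of `X_d` with `α(e_j) = -e_j` for `j ≤ d + 1` and
`α(e_{d+2}) = e_{d+2}`. -/
def alpha (d : ℕ) : X d →ₐ[ℝ] X d :=
  lift d
    (FreeAlgebra.lift ℝ (Fin.lastCases (motive := fun _ => X d) (e d (Fin.last (d + 1)))
        (fun j => -e d j.castSucc))) (by
      intro x y h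
      cases h with
      | anticomm j k hjk => simpa using e_anticomm d j k hjk
      | sq j => simpa using e_sq d j
      | sq_last => simpa using e_sq_last d
      | comm_last j =>
        have h := e_comm_last d j
        simp only [map_sub, map_mul, FreeAlgebra.lift_ι_apply, Fin.lastCases_last,
          Fin.lastCases_castSucc, map_zero, mul_neg, neg_mul]
        rw [neg_sub_neg, ← neg_sub, h, neg_zero])

/-- The anti-automorphism `t` of `X_d` fixing all generators, as a homomorphism into the opposite
algebra. -/
def tOp (d : ℕ) : X d →ₐ[ℝ] (X d)ᵐᵒᵖ :=
  lift d
    (FreeAlgebra.lift ℝ (fun j => MulOpposite.op (e d j))) (by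
      intro x y h
      apply MulOpposite.unop_injective
      cases h with
      | anticomm j k hjk =>
        simpa [add_comm] using e_anticomm d j k hjk
      | sq j => simpa using e_sq d j
      | sq_last => simpa using e_sq_last d
      | comm_last j =>
        have h := e_comm_last d j
        simp only [map_sub, map_mul, FreeAlgebra.lift_ι_apply, map_zero, MulOpposite.unop_sub,
          MulOpposite.unop_mul, MulOpposite.unop_op, MulOpposite.unop_zero]
        rw [← neg_sub, h, neg_zero])

/-- The conjugate `x̄ = α(t(x))`. -/
def conj (d : ℕ) (x : X d) : X d := alpha d (MulOpposite.unop (tOp d x))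

/-- The linear map `i : ℝ^d → X_d` taking the standard basis to `e_1, …, e_d`. -/
def i {d : ℕ} (v : EuclideanSpace ℝ (Fin d)) : X d :=
  ∑ j : Fin d, v j • e d j.castSucc.castSucc

/-- The list of elements `e_1, …, e_d, e_{d+1}e_{d+2}`, the last being a single element. -/
def f (d : ℕ) : Fin (d + 1) → X d :=
  Fin.lastCases (motive := fun _ => X d) (eRot d * eNil d) (fun j => e d j.castSucc.castSucc)

/-- The product, in increasing order, of the distinct elements `f j`, `j ∈ S`; the empty product
is `1`.  For `S` of even size these are the `2 ^ d` standard basis elements of `Z_d^0`. -/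
def mono (d : ℕ) (S : Finset (Fin (d + 1))) : X d :=
  (List.ofFn fun j : Fin (d + 1) => if j ∈ S then f d j else 1).prod

/-- The subspace `Z_d^0` of `X_d`, spanned by products of an even number of elements of
`{e_1, …, e_d, e_{d+1}e_{d+2}}` (including the empty product `1`). -/
def Z0 (d : ℕ) : Submodule ℝ (X d) :=
  Submodule.span ℝ {x | ∃ S : Finset (Fin (d + 1)), Even S.card ∧ mono d S = x}

/-- The hyperplane `H_0` of `Z_d^0 ≅ ℝ^(2^d)` where the coordinate belonging to the standard basis
element `1` vanishes, that is, the span of all the other standard basis elements of `Z_d^0`. -/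
def H0 (d : ℕ) : Submodule ℝ (X d) :=
  Submodule.span ℝ {x | ∃ S : Finset (Fin (d + 1)), Even S.card ∧ S.Nonempty ∧ mono d S = x}

/-- The copy `e_{d+2} i(v) + e_{d+1}` in `X_d` of the point `v` of `ℝ^d`. -/
def pt {d : ℕ} (v : EuclideanSpace ℝ (Fin d)) : X d := eNil d * i v + eRot d

/-- The group `Spun(d)`, as a subset of `X_d`: the `z ∈ Z_d^0` with `N(z) = z z̄ = 1` such that
`x ↦ z x z̄` maps `e_{d+2} i(ℝ^d) + e_{d+1}` to itself. -/
def Spun (d : ℕ) : Set (X d) :=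
  {z | z ∈ Z0 d ∧ z * conj d z = 1 ∧
    ∀ v : EuclideanSpace ℝ (Fin d), ∃ w : EuclideanSpace ℝ (Fin d),
      z * pt v * conj d z = pt w}

/-- The set `T_{ap}` of all `x ∈ Spun(d)` with `a^x = p`, where `a^x` is the point of `ℝ^d`
determined by `x (e_{d+2} i(a) + e_{d+1}) x̄ = e_{d+2} i(a^x) + e_{d+1}`. -/
def T {d : ℕ} (a p : EuclideanSpace ℝ (Fin d)) : Set (X d) :=
  {x | x ∈ Spun d ∧ x * pt a * conj d x = pt p}

end

end SpunGroup

/-! The coordinate at `1` is detected by a trace. Real matrices realising `e_1, …, e_{d+1}`, with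
`e_{d+2}` sent to the dual-number unit ε, represent `X_d`; let `φ` be the reduction modulo ε and `δ`
the ε-coefficient. The trace of `φ` vanishes on every nonempty even monomial, but not on `1`, so
within `Z0` it vanishes exactly on `H0` (`trace_map_eq_zero_of_mem_H0`,
`mem_H0_of_trace_map_eq_zero`).

For `z` in both sets, put `c = a - b` and `c' = p - q`. Subtracting the two incidence equations and
applying `δ` shows that conjugation by `φ z` takes `φ (i c)` to `φ (i c')` (`map_mul_i_mul_conj`).
If `c' = -c`, then `φ z` anticommutes with a matrix whose square is a nonzero scalar, so its trace
is zero (`trace_eq_zero_of_conj_neg`).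

Conversely, any common element forces `‖c‖ = ‖c'‖`. If also `c + c' ≠ 0`, reflecting in `c` and then
in `c + c'` rotates `c` to `c'`, and a translation adjusts the image of `a` to `p`. The resulting
element has trace a nonzero multiple of `⟪c + c', c⟫`, which is nonzero, so it lies outside `H0`
(`exists_mem_of_norm_eq`). -/

namespace SpunGroup

/-! ### Ordered products of anticommuting elements -/

section Monomials

variable {R : Type*} [Ring R] [Algebra ℝ R]

/-- The ordered product of the `g j` with `s j` true. -/
def orderedProd {n : ℕ} (g : Fin n → R) (s : Fin n → Bool) : R :=
  (List.ofFn fun j => if s j then g j else 1).prod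

/-- The number of factors of `orderedProd`. -/
def numTrue {n : ℕ} (s : Fin n → Bool) : ℕ := ∑ j, (s j).toNat

omit [Algebra ℝ R] in
theorem orderedProd_succ {n : ℕ} (g : Fin (n + 1) → R) (s : Fin (n + 1) → Bool) :
    orderedProd g s
      = (if s 0 then g 0 else 1) * orderedProd (fun j => g j.succ) (fun j => s j.succ) := by
  simp [orderedProd, List.ofFn_succ]

theorem numTrue_succ {n : ℕ} (s : Fin (n + 1) → Bool) :
    numTrue s = (s 0).toNat + numTrue (fun j => s j.succ) := by
  simp [numTrue, Fin.sum_univ_succ]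

theorem mul_orderedProd_of_anticomm {n : ℕ} (x : R) (g : Fin n → R)
    (h : ∀ j, x * g j = -(g j * x)) (s : Fin n → Bool) :
    x * orderedProd g s = (-1 : ℝ) ^ numTrue s • (orderedProd g s * x) := by
  induction n with
  | zero => simp [orderedProd, numTrue]
  | succ n ih =>
    rw [orderedProd_succ, numTrue_succ]
    have ih' := ih (fun j => g j.succ) (fun j => h _) (fun j => s j.succ)
    cases hs : s 0 with
    | false => simpa using ih'
    | true =>
      simp only [if_true, Bool.toNat_true, pow_add, pow_one]
      rw [← mul_assoc, h, neg_mul, mul_assoc, ih']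
      simp [mul_assoc]

/-- Moving `g j` into its slot costs a sign and toggles `s j`. Parity flips formally even if `r j =
0`, where the product itself vanishes. -/
theorem exists_mul_orderedProd {n : ℕ} (g : Fin n → R)
    (h : ∀ j k, j ≠ k → g j * g k = -(g k * g j)) (r : Fin n → ℝ)
    (hr : ∀ j, g j * g j = r j • (1 : R)) (j : Fin n) (s : Fin n → Bool) :
    ∃ (c : ℝ) (s' : Fin n → Bool), (Even (numTrue s') ↔ ¬ Even (numTrue s)) ∧
      g j * orderedProd g s = c • orderedProd g s' := by
  induction n with
  | zero => exact j.elim0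
  | succ n ih =>
    refine Fin.cases ?_ (fun k => ?_) j
    · refine ⟨if s 0 then r 0 else 1, Fin.cons (!s 0) (fun j => s j.succ), ?_, ?_⟩
      · rw [numTrue_succ, numTrue_succ s]
        cases hs : s 0 <;> simp [add_comm 1, Nat.even_add_one]
      · rw [orderedProd_succ, orderedProd_succ]
        cases hs : s 0
        · simp
        · simp [← mul_assoc, hr]
    · obtain ⟨c, s', hp, he⟩ := ih (fun j => g j.succ)
        (fun j k hjk => h _ _ (by simpa using hjk)) (fun j => r j.succ) (fun j => hr _) k
        (fun j => s j.succ)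
      refine ⟨if s 0 then -c else c, Fin.cons (s 0) s', ?_, ?_⟩
      · rw [numTrue_succ, numTrue_succ s]
        simp only [Fin.cons_zero, Fin.cons_succ, Nat.even_add, hp]
        tauto
      · rw [orderedProd_succ, orderedProd_succ]
        cases hs : s 0
        · simpa using he
        · simp only [if_true, Fin.cons_zero, Fin.cons_succ]
          rw [← mul_assoc, h _ _ (Fin.succ_ne_zero k), neg_mul, mul_assoc, he]
          simp

/-- The first factor present anticommutes with the product of the remaining ones, which are odd in
number; cyclicity of `τ` then equates the value with its negative. Squares play no role, so
nilpotent factors are allowed. -/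
theorem map_orderedProd_eq_zero {n : ℕ} (τ : R →ₗ[ℝ] ℝ) (hτ : ∀ x y, τ (x * y) = τ (y * x))
    (g : Fin n → R) (h : ∀ j k, j ≠ k → g j * g k = -(g k * g j)) (s : Fin n → Bool)
    (heven : Even (numTrue s)) (hne : ∃ j, s j) : τ (orderedProd g s) = 0 := by
  induction n with
  | zero => exact hne.choose.elim0
  | succ n ih =>
    rw [orderedProd_succ]
    rw [numTrue_succ] at heven
    cases hs : s 0 with
    | false =>
      simp only [Bool.false_eq_true, if_false, one_mul]
      refine ih (fun j => g j.succ) (fun j k hjk => h _ _ (by simpa using hjk)) _ ?_ ?_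
      · simpa [hs] using heven
      · obtain ⟨j, hj⟩ := hne
        induction j using Fin.cases with
        | zero => simp [hs] at hj
        | succ k => exact ⟨k, hj⟩
    | true =>
      simp only [if_true]
      have hodd : Odd (numTrue fun j => s j.succ) := by
        rw [hs, Bool.toNat_true, add_comm, Nat.even_add_one] at heven
        exact Nat.not_even_iff_odd.1 heven
      have h1 := mul_orderedProd_of_anticomm (g 0) (fun j => g j.succ)
        (fun j => h _ _ (Fin.succ_ne_zero j).symm) (fun j => s j.succ)
      rw [hodd.neg_one_pow] at h1
      have h2 := congrArg τ h1
      rw [map_smul, hτ _ (g 0), smul_eq_mul] at h2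
      linarith

end Monomials

/-! ### Matrix and dual-number models of `X_d` -/

/-- Real matrices that pairwise anticommute and square to `-1`. -/
theorem exists_anticomm_matrices (n : ℕ) : ∃ (m : Type) (_ : Fintype m) (_ : DecidableEq m)
    (_ : Nonempty m) (M : Fin n → Matrix m m ℝ),
    (∀ j k, j ≠ k → M j * M k + M k * M j = 0) ∧ ∀ j, M j * M j + 1 = 0 := by
  induction n with
  | zero => exact ⟨Unit, inferInstance, inferInstance, inferInstance, fun j => j.elim0,
      fun j => j.elim0, fun j => j.elim0⟩
  | succ n ih =>
    obtain ⟨m, hm, hd, hne, M, h1, h2⟩ := ih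
    refine ⟨m ⊕ m, inferInstance, inferInstance, inferInstance,
      -- Doubling the size: the new off-diagonal matrix swaps the two blocks, so it anticommutes
      -- with each `diag(M j, -M j)`.
      Fin.cons (Matrix.fromBlocks 0 1 (-1) 0)
        (fun j => Matrix.fromBlocks (M j) 0 0 (-M j)), ?_, ?_⟩
    · intro j k
      refine Fin.cases ?_ (fun j => ?_) j <;> refine Fin.cases ?_ (fun k => ?_) k
      · simp
      · simp [-Matrix.fromBlocks_one, Matrix.fromBlocks_multiply, Matrix.fromBlocks_add]
      · simp [-Matrix.fromBlocks_one, Matrix.fromBlocks_multiply, Matrix.fromBlocks_add]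
      · intro hjk
        simp [Matrix.fromBlocks_multiply, Matrix.fromBlocks_add, h1 j k (by simpa using hjk)]
    · intro j
      rw [← Matrix.fromBlocks_one]
      refine Fin.cases ?_ (fun j => ?_) j
      · simp [-Matrix.fromBlocks_one, Matrix.fromBlocks_multiply, Matrix.fromBlocks_add]
      · simp [-Matrix.fromBlocks_one, Matrix.fromBlocks_multiply, Matrix.fromBlocks_add, h2]

/-- The algebra map `X_d → A[ε]` sending `e_1, …, e_{d+1}` to the given elements of `A` and
`e_{d+2}` to `ε`. -/
noncomputable def toDual (d : ℕ) {A : Type*} [Ring A] [Algebra ℝ A] (M : Fin (d + 1) → A)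
    (h1 : ∀ j k, j ≠ k → M j * M k + M k * M j = 0) (h2 : ∀ j, M j * M j + 1 = 0) :
    X d →ₐ[ℝ] DualNumber A :=
  lift d (FreeAlgebra.lift ℝ (Fin.lastCases (motive := fun _ => DualNumber A) DualNumber.eps
    (fun j => TrivSqZeroExt.inl (M j)))) (by
      intro x y h
      cases h with
      | anticomm j k hjk =>
        simp [← TrivSqZeroExt.inl_mul, ← TrivSqZeroExt.inl_add, h1 j k hjk]
      | sq j =>
        simp [← TrivSqZeroExt.inl_mul, ← TrivSqZeroExt.inl_add, ← TrivSqZeroExt.inl_one, h2 j]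
      | sq_last => simp
      | comm_last j =>
        simp only [map_sub, map_mul, FreeAlgebra.lift_ι_apply, map_zero, Fin.lastCases_last,
          Fin.lastCases_castSucc]
        ext <;> simp)

section
variable (d : ℕ) {A : Type*} [Ring A] [Algebra ℝ A] (M : Fin (d + 1) → A)
    (h1 : ∀ j k, j ≠ k → M j * M k + M k * M j = 0) (h2 : ∀ j, M j * M j + 1 = 0)

theorem toDual_eNil : toDual d M h1 h2 (eNil d) = DualNumber.eps := by
  simp [toDual, eNil, e, lift_mk]

theorem fst_toDual_eNil : (toDual d M h1 h2 (eNil d)).fst = 0 := by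
  simp [toDual_eNil]

theorem snd_toDual_eNil_mul (x : X d) :
    (toDual d M h1 h2 (eNil d * x)).snd = (toDual d M h1 h2 x).fst := by
  simp [toDual_eNil]

end
variable {d : ℕ}

/-! ### Relations, conjugation and parity in `X_d` -/

theorem eRot_sq : eRot d * eRot d = -1 := eq_neg_of_add_eq_zero_left (e_sq d _)

theorem eNil_sq : eNil d * eNil d = 0 := e_sq_last d

theorem eNil_mul_eRot : eNil d * eRot d = eRot d * eNil d := sub_eq_zero.1 (e_comm_last d _)

theorem eNil_mul_i (v : EuclideanSpace ℝ (Fin d)) : eNil d * i v = i v * eNil d := by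
  simp only [i, Finset.mul_sum, Finset.sum_mul, mul_smul_comm, smul_mul_assoc]
  exact Finset.sum_congr rfl fun j _ => congrArg _ (sub_eq_zero.1 (e_comm_last d _))

theorem eRot_mul_i (v : EuclideanSpace ℝ (Fin d)) : eRot d * i v = -(i v * eRot d) := by
  simp only [i, Finset.mul_sum, Finset.sum_mul, mul_smul_comm, smul_mul_assoc,
    ← Finset.sum_neg_distrib, ← smul_neg]
  exact Finset.sum_congr rfl fun j _ => congrArg _
    (eq_neg_of_add_eq_zero_left (e_anticomm d _ _ (Fin.castSucc_lt_last j).ne'))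

theorem i_add (v w : EuclideanSpace ℝ (Fin d)) : i (v + w) = i v + i w := by
  simp [i, add_smul, Finset.sum_add_distrib]

theorem i_smul (c : ℝ) (v : EuclideanSpace ℝ (Fin d)) : i (c • v) = c • i v := by
  simp [i, mul_smul, Finset.smul_sum]

theorem i_neg (v : EuclideanSpace ℝ (Fin d)) : i (-v) = -i v := by
  simpa using i_smul (-1) v

theorem i_sub (v w : EuclideanSpace ℝ (Fin d)) : i (v - w) = i v - i w := by
  rw [sub_eq_add_neg, i_add, i_neg, ← sub_eq_add_neg]

theorem i_mul_i_add (v w : EuclideanSpace ℝ (Fin d)) :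
    i v * i w + i w * i v = (-(2 * inner ℝ v w)) • (1 : X d) := by
  have key : ∀ j k : Fin d, e d j.castSucc.castSucc * e d k.castSucc.castSucc
      + e d k.castSucc.castSucc * e d j.castSucc.castSucc
      = if j = k then (-2 : ℝ) • (1 : X d) else 0 := by
    intro j k
    split_ifs with h
    · subst h
      rw [eq_neg_of_add_eq_zero_left (e_sq d j.castSucc), neg_smul, two_smul]
      abel
    · exact e_anticomm d _ _ (by simpa using h)
  have h2 : i w * i v = ∑ j, ∑ k, (v j * w k) • (e d k.castSucc.castSucc
      * e d j.castSucc.castSucc) := by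
    rw [i, i, Finset.sum_mul_sum, Finset.sum_comm]
    simp [smul_smul]
  have h1 : i v * i w = ∑ j, ∑ k, (v j * w k) • (e d j.castSucc.castSucc
      * e d k.castSucc.castSucc) := by
    rw [i, i, Finset.sum_mul_sum]
    simp [smul_smul, mul_comm]
  rw [h1, h2]
  simp only [← Finset.sum_add_distrib, ← smul_add, key]
  simp only [smul_ite, smul_zero, Finset.sum_ite_eq, Finset.mem_univ, if_true, smul_smul,
    ← Finset.sum_smul]
  congr 1
  rw [PiLp.inner_apply, Finset.mul_sum, ← Finset.sum_neg_distrib]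
  refine Finset.sum_congr rfl fun j _ => ?_
  simp
  ring

theorem i_sq (v : EuclideanSpace ℝ (Fin d)) : i v * i v = (-‖v‖ ^ 2) • (1 : X d) := by
  have h := i_mul_i_add v v
  rw [real_inner_self_eq_norm_sq, ← two_smul ℝ] at h
  have h' := congrArg (fun x => (2⁻¹ : ℝ) • x) h
  simp only [smul_smul] at h'
  norm_num at h'
  simpa using h'

theorem conj_mul (x y : X d) : conj d (x * y) = conj d y * conj d x := by simp [conj]

theorem conj_add (x y : X d) : conj d (x + y) = conj d x + conj d y := by simp [conj]

theorem conj_smul (c : ℝ) (x : X d) : conj d (c • x) = c • conj d x := by simp [conj]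

theorem conj_one : conj d 1 = 1 := by simp [conj]

theorem conj_eRot : conj d (eRot d) = -eRot d := by
  simp [conj, alpha, tOp, eRot, e, lift_mk]

theorem conj_eNil : conj d (eNil d) = eNil d := by
  simp [conj, alpha, tOp, eNil, e, lift_mk]

theorem conj_i (v : EuclideanSpace ℝ (Fin d)) : conj d (i v) = -i v := by
  simp [conj, alpha, tOp, i, e, lift_mk]

/-- The span of the monomials whose number of factors has the given parity. -/
noncomputable def paritySpan (d : ℕ) (even : Prop) : Submodule ℝ (X d) :=
  Submodule.span ℝ {x | ∃ s, (Even (numTrue s) ↔ even) ∧ orderedProd (f d) s = x}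

theorem mono_eq_orderedProd (S : Finset (Fin (d + 1))) :
    mono d S = orderedProd (f d) (fun j => decide (j ∈ S)) := by
  simp [mono, orderedProd]

theorem card_eq_numTrue (S : Finset (Fin (d + 1))) :
    S.card = numTrue (fun j => decide (j ∈ S)) := by
  simp [numTrue, Bool.toNat, Bool.cond_decide]

theorem paritySpan_true_le : paritySpan d True ≤ Z0 d := by
  refine Submodule.span_mono ?_
  rintro _ ⟨s, hs, rfl⟩
  have h : s = fun j => decide (j ∈ Finset.univ.filter fun j => s j = true) := by
    ext j; simp
  refine ⟨Finset.univ.filter fun j => s j = true, ?_, ?_⟩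
  · rw [card_eq_numTrue, ← h]
    simpa using hs
  · rw [mono_eq_orderedProd, ← h]

theorem f_castSucc (j : Fin d) : f d j.castSucc = e d j.castSucc.castSucc := by simp [f]

theorem f_last : f d (Fin.last d) = eRot d * eNil d := by simp [f]

theorem f_anticomm (j k : Fin (d + 1)) (hjk : j ≠ k) : f d j * f d k = -(f d k * f d j) := by
  have key : ∀ j : Fin d, e d j.castSucc.castSucc * (eRot d * eNil d)
      = -(eRot d * eNil d * e d j.castSucc.castSucc) := by
    intro j
    have h1 := sub_eq_zero.1 (e_comm_last d j.castSucc)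
    have h2 := eq_neg_of_add_eq_zero_left
      (e_anticomm d j.castSucc (Fin.last d) (Fin.castSucc_lt_last j).ne)
    change eNil d * _ = _ * eNil d at h1
    change _ * eRot d = -(eRot d * _) at h2
    rw [mul_assoc, h1, ← mul_assoc, ← mul_assoc, h2, neg_mul]
  induction j using Fin.lastCases with
  | last =>
    induction k using Fin.lastCases with
    | last => exact absurd rfl hjk
    | cast k => rw [f_last, f_castSucc, key, neg_neg]
  | cast j =>
    induction k using Fin.lastCases with
    | last => rw [f_last, f_castSucc, key]
    | cast k =>
      rw [f_castSucc, f_castSucc]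
      exact eq_neg_of_add_eq_zero_left (e_anticomm d _ _ hjk)

theorem eRot_mul_eNil_sq : eRot d * eNil d * (eRot d * eNil d) = 0 := by
  rw [mul_assoc, ← mul_assoc (eNil d), eNil_mul_eRot, mul_assoc (eRot d), eNil_sq, mul_zero,
    mul_zero]

theorem f_sq (j : Fin (d + 1)) :
    f d j * f d j = (Fin.lastCases (motive := fun _ => ℝ) 0 (fun _ => -1) j : ℝ) • (1 : X d) := by
  induction j using Fin.lastCases with
  | last => simp [f_last, eRot_mul_eNil_sq]
  | cast j =>
    rw [f_castSucc, eq_neg_of_add_eq_zero_left (e_sq d j.castSucc)]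
    simp

theorem f_mul_mem_paritySpan (j : Fin (d + 1)) {p : Prop} {x : X d} (hx : x ∈ paritySpan d p) :
    f d j * x ∈ paritySpan d (¬p) := by
  induction hx using Submodule.span_induction with
  | mem x hx =>
    obtain ⟨s, hs, rfl⟩ := hx
    obtain ⟨c, s', hp, he⟩ := exists_mul_orderedProd (f d) f_anticomm _ f_sq j s
    rw [he]
    exact Submodule.smul_mem _ _ (Submodule.subset_span ⟨s', by rw [hp, hs], rfl⟩)
  | zero => simp
  | add x y _ _ hx hy => rw [mul_add]; exact add_mem hx hy
  | smul c x _ hx => rw [mul_smul_comm]; exact Submodule.smul_mem _ _ hx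

theorem i_mul_mem_paritySpan (v : EuclideanSpace ℝ (Fin d)) {p : Prop} {x : X d}
    (hx : x ∈ paritySpan d p) : i v * x ∈ paritySpan d (¬p) := by
  rw [i, Finset.sum_mul]
  refine Submodule.sum_mem _ fun j _ => ?_
  rw [smul_mul_assoc, ← f_castSucc]
  exact Submodule.smul_mem _ _ (f_mul_mem_paritySpan _ hx)

theorem one_mem_paritySpan : (1 : X d) ∈ paritySpan d True :=
  Submodule.subset_span ⟨fun _ => false, by simp [numTrue], by simp [orderedProd]⟩

theorem pt_sub_pt (a b : EuclideanSpace ℝ (Fin d)) : pt a - pt b = eNil d * i (a - b) := by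
  rw [pt, pt, i_sub, mul_sub]; abel

/-! ### Reflections and translations acting on points -/

/-- Conjugating a point by a vector `g` reflects it in the hyperplane orthogonal to `g`, up to a
factor. -/
theorem i_mul_pt_mul_i (g v : EuclideanSpace ℝ (Fin d)) :
    eNil d * i (‖g‖ ^ 2 • v - (2 * inner ℝ v g) • g) + ‖g‖ ^ 2 • eRot d
      = -(i g * pt v * conj d (i g)) := by
  have h1 : i g * i v * i g = i (‖g‖ ^ 2 • v - (2 * inner ℝ v g) • g) := by
    rw [eq_sub_of_add_eq' (i_mul_i_add v g), sub_mul, mul_assoc, i_sq, i_sub, i_smul, i_smul]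
    simp only [Algebra.mul_smul_comm, Algebra.smul_mul_assoc, one_mul, mul_one, neg_smul, neg_mul,
      mul_neg]
    abel
  have h2 : i g * eRot d * i g = ‖g‖ ^ 2 • eRot d := by
    rw [mul_assoc, eRot_mul_i, mul_neg, ← mul_assoc, i_sq]
    simp
  rw [conj_i, pt, mul_neg, neg_neg, mul_add, add_mul, h2, ← mul_assoc, ← eNil_mul_i,
    mul_assoc (eNil d), mul_assoc (eNil d), h1]

theorem conj_eRot_mul_eNil_mul_i (x : EuclideanSpace ℝ (Fin d)) :
    conj d (eRot d * eNil d * i x) = -(eNil d * (eRot d * i x)) := by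
  rw [conj_mul, conj_mul, conj_i, conj_eNil, conj_eRot, eRot_mul_i, ← mul_assoc, neg_mul,
    ← eNil_mul_i]
  simp [mul_assoc]

theorem eNil_mul_mul_eNil_mul (x : EuclideanSpace ℝ (Fin d)) (y : X d) :
    eNil d * (eRot d * i x) * (eNil d * y) = 0 := by
  rw [← mul_assoc, mul_assoc (eNil d), mul_assoc (eRot d), ← eNil_mul_i, ← mul_assoc (eRot d),
    ← eNil_mul_eRot, mul_assoc (eNil d) (eRot d), ← mul_assoc (eNil d) (eNil d), eNil_sq,
    zero_mul, zero_mul]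

/-- Since `e_{d+2}` squares to zero, only first-order terms survive; the left and right factors each
contribute `eNil d * i x`, hence the factor 2. -/
theorem translation_mul_pt (x v : EuclideanSpace ℝ (Fin d)) :
    (1 + eRot d * eNil d * i x) * pt v * conj d (1 + eRot d * eNil d * i x)
      = pt (v + (2 : ℝ) • x) := by
  have h1 : eRot d * i x * eRot d = i x := by
    rw [eRot_mul_i, neg_mul, mul_assoc, eRot_sq, mul_neg, mul_one, neg_neg]
  have h2 : eRot d * (eRot d * i x) = -i x := by
    rw [← mul_assoc, eRot_sq, neg_mul, one_mul]
  have h3 : eRot d * (eNil d * (eRot d * i x)) = -(eNil d * i x) := by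
    rw [← mul_assoc, ← eNil_mul_eRot, mul_assoc, h2, mul_neg]
  have h4 : eNil d * i v * (eNil d * (eRot d * i x)) = 0 := by
    rw [mul_assoc, ← mul_assoc (i v), ← eNil_mul_i, mul_assoc (eNil d), ← mul_assoc (eNil d),
      eNil_sq, zero_mul]
  have h5 : eNil d * i x * (eNil d * (eRot d * i x)) = 0 := by
    rw [mul_assoc, ← mul_assoc (i x), ← eNil_mul_i, mul_assoc (eNil d), ← mul_assoc (eNil d),
      eNil_sq, zero_mul]
  rw [conj_add, conj_one, conj_eRot_mul_eNil_mul_i, ← eNil_mul_eRot, mul_assoc (eNil d) (eRot d)]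
  have h6 : (1 + eNil d * (eRot d * i x)) * pt v = pt v + eNil d * i x := by
    rw [pt, add_mul, mul_add, mul_add, eNil_mul_mul_eNil_mul, mul_assoc (eNil d), h1]
    simp
  rw [h6, pt, pt, mul_add, mul_neg, add_mul _ _ (eNil d * _), add_mul _ _ (eNil d * _), h3, h4, h5, i_add, i_smul, two_smul, mul_add,
    mul_add]
  simp only [mul_one]
  abel

theorem translation_mul_conj (x : EuclideanSpace ℝ (Fin d)) :
    (1 + eRot d * eNil d * i x) * conj d (1 + eRot d * eNil d * i x) = 1 := by
  rw [conj_add, conj_one, conj_eRot_mul_eNil_mul_i, ← eNil_mul_eRot, mul_assoc (eNil d) (eRot d),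
    add_mul, mul_add, mul_add, mul_neg (eNil d * _), eNil_mul_mul_eNil_mul]
  simp

/-! ### Representation and trace -/

/-- A finite-dimensional representation of `X_d` over the dual numbers, split into its reduction
`φ` and its infinitesimal part `δ`. -/
theorem exists_representation (d : ℕ) : ∃ (m : Type) (_ : Fintype m) (_ : DecidableEq m)
    (_ : Nonempty m) (φ : X d →ₐ[ℝ] Matrix m m ℝ) (δ : X d → Matrix m m ℝ),
    φ (eNil d) = 0 ∧ (∀ x, δ (eNil d * x) = φ x) ∧
      ∀ x y, δ (x * y) = φ x * δ y + δ x * φ y := by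
  obtain ⟨m, hm, hd, hne, M, h1, h2⟩ := exists_anticomm_matrices (d + 1)
  refine ⟨m, hm, hd, hne, (TrivSqZeroExt.fstHom ℝ _ _).comp (toDual d M h1 h2),
    fun x => (toDual d M h1 h2 x).snd, ?_, ?_, ?_⟩
  · exact fst_toDual_eNil d M h1 h2
  · exact snd_toDual_eNil_mul d M h1 h2
  · intro x y
    simp [TrivSqZeroExt.snd_mul]

section Representation

variable {m : Type} [Fintype m] [DecidableEq m] (φ : X d →ₐ[ℝ] Matrix m m ℝ)

/-- `φ` alone would kill both sides of `h`. In the Leibniz expansion of `δ`, only the term that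
differentiates the middle factor survives. -/
theorem map_mul_i_mul_conj (δ : X d → Matrix m m ℝ) (h0 : φ (eNil d) = 0)
    (h1 : ∀ x, δ (eNil d * x) = φ x) (h2 : ∀ x y, δ (x * y) = φ x * δ y + δ x * φ y)
    {z y : X d} {c c' : EuclideanSpace ℝ (Fin d)}
    (h : z * (eNil d * i c) * y = eNil d * i c') : φ z * φ (i c) * φ y = φ (i c') := by
  have := congrArg δ h
  rw [h1, h2, h2 z, h1] at this
  simpa [h0] using this

theorem map_i_sq (v : EuclideanSpace ℝ (Fin d)) :
    φ (i v) * φ (i v) = (-‖v‖ ^ 2) • (1 : Matrix m m ℝ) := by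
  rw [← map_mul, i_sq, map_smul, map_one]

/-- Conjugation fixes scalar matrices, and the square of `φ (i c)` is the scalar `-‖c‖ ^ 2`. -/
theorem norm_eq_of_conj [Nonempty m] {U V : Matrix m m ℝ} (hUV : U * V = 1)
    {c c' : EuclideanSpace ℝ (Fin d)} (h : U * φ (i c) * V = φ (i c')) : ‖c‖ = ‖c'‖ := by
  have hVU : V * U = 1 := mul_eq_one_comm.1 hUV
  have h1 := map_i_sq φ c'
  rw [← h, show U * φ (i c) * V * (U * φ (i c) * V) = U * (φ (i c) * (V * U) * φ (i c)) * V by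
    simp only [mul_assoc], hVU, mul_one, map_i_sq, mul_smul_comm, smul_mul_assoc, mul_one,
    hUV] at h1
  have h2 := smul_left_injective ℝ (one_ne_zero (α := Matrix m m ℝ)) h1
  have h3 : ‖c‖ ^ 2 = ‖c'‖ ^ 2 := by simpa using h2
  exact (pow_left_inj₀ (norm_nonneg _) (norm_nonneg _) two_ne_zero).1 h3

theorem trace_eq_zero_of_conj_neg {U V : Matrix m m ℝ} (hUV : U * V = 1)
    {c : EuclideanSpace ℝ (Fin d)} (hc : c ≠ 0) (h : U * φ (i c) * V = φ (i (-c))) :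
    U.trace = 0 := by
  have hVU : V * U = 1 := mul_eq_one_comm.1 hUV
  have h1 : U * φ (i c) = -(φ (i c) * U) := by
    rw [i_neg, map_neg] at h
    rw [← neg_mul, ← h, mul_assoc _ V U, hVU, mul_one]
  have h2 : (U * (φ (i c) * φ (i c))).trace = 0 := by
    have : (U * (φ (i c) * φ (i c))).trace = -(U * (φ (i c) * φ (i c))).trace := by
      conv_lhs => rw [← mul_assoc, h1, neg_mul, Matrix.trace_neg, mul_assoc, Matrix.trace_mul_comm,
        mul_assoc]
    linarith
  rw [map_i_sq, mul_smul_comm, mul_one, Matrix.trace_smul, smul_eq_mul] at h2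
  simpa [hc] using h2

theorem trace_map_mono (S : Finset (Fin (d + 1))) (hS : Even S.card) (hne : S.Nonempty) :
    (φ (mono d S)).trace = 0 := by
  rw [mono_eq_orderedProd]
  refine map_orderedProd_eq_zero ((Matrix.traceLinearMap m ℝ ℝ).comp φ.toLinearMap) ?_ (f d)
    f_anticomm _ (by rwa [← card_eq_numTrue]) ?_
  · intro x y
    simp [Matrix.trace_mul_comm (φ x)]
  · obtain ⟨j, hj⟩ := hne
    exact ⟨j, by simpa using hj⟩

theorem trace_map_eq_zero_of_mem_H0 {x : X d} (hx : x ∈ H0 d) : (φ x).trace = 0 := by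
  have : H0 d ≤ LinearMap.ker ((Matrix.traceLinearMap m ℝ ℝ).comp φ.toLinearMap) := by
    refine Submodule.span_le.2 ?_
    rintro _ ⟨S, hS, hne, rfl⟩
    exact trace_map_mono φ S hS hne
  exact this hx

/-- `Z0` is contained in `ℝ·1 + H0`, and the trace reads off the coefficient of `1`; linear
independence of the monomials is not needed. -/
theorem mem_H0_of_trace_map_eq_zero [Nonempty m] {x : X d} (hx : x ∈ Z0 d)
    (h : (φ x).trace = 0) : x ∈ H0 d := by
  have hle : Z0 d ≤ Submodule.span ℝ {1} ⊔ H0 d := by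
    refine Submodule.span_le.2 ?_
    rintro _ ⟨S, hS, rfl⟩
    rcases S.eq_empty_or_nonempty with rfl | hne
    · exact Submodule.mem_sup_left (Submodule.subset_span (by simp [mono]))
    · exact Submodule.mem_sup_right (Submodule.subset_span ⟨S, hS, hne, rfl⟩)
  obtain ⟨y, hy, w, hw, rfl⟩ := Submodule.mem_sup.1 (hle hx)
  obtain ⟨r, rfl⟩ := Submodule.mem_span_singleton.1 hy
  rw [map_add, Matrix.trace_add, trace_map_eq_zero_of_mem_H0 φ hw] at h
  have hr : r = 0 := by simpa using h
  simpa [hr] using hw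

theorem trace_map_i_mul_i (g c : EuclideanSpace ℝ (Fin d)) :
    (φ (i g * i c)).trace = -inner ℝ g c * (1 : Matrix m m ℝ).trace := by
  have h := congrArg (fun x => (φ x).trace) (i_mul_i_add g c)
  simp only [map_add, map_mul, map_smul, map_one, Matrix.trace_add, Matrix.trace_smul,
    smul_eq_mul] at h
  rw [Matrix.trace_mul_comm (φ (i c))] at h
  rw [map_mul]
  linarith

end Representation

/-! ### Constructing a common element outside `H0` -/

/-- The element `(1 + e_{d+1} e_{d+2} x) k g c`, acting on `ℝ^d` by two reflections followed by a
translation. -/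
noncomputable def rotTrans (k : ℝ) (g c x : EuclideanSpace ℝ (Fin d)) : X d :=
  k • ((1 + eRot d * eNil d * i x) * (i g * i c))

theorem rotTrans_mem_Z0 (k : ℝ) (g c x : EuclideanSpace ℝ (Fin d)) : rotTrans k g c x ∈ Z0 d := by
  have h1 := i_mul_mem_paritySpan g (i_mul_mem_paritySpan c one_mem_paritySpan)
  have h2 := f_mul_mem_paritySpan (Fin.last d) (i_mul_mem_paritySpan x h1)
  rw [mul_one, f_last] at h2
  rw [mul_one] at h1
  simp only [not_true, not_false_eq_true] at h1 h2
  refine Submodule.smul_mem _ _ ?_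
  rw [add_mul, one_mul, mul_assoc (eRot d * eNil d)]
  exact add_mem (paritySpan_true_le h1) (paritySpan_true_le h2)

theorem rotTrans_mul_conj {k : ℝ} {g c : EuclideanSpace ℝ (Fin d)}
    (hk : k ^ 2 * (‖g‖ ^ 2 * ‖c‖ ^ 2) = 1) (x : EuclideanSpace ℝ (Fin d)) :
    rotTrans k g c x * conj d (rotTrans k g c x) = 1 := by
  have h1 : i g * i c * conj d (i g * i c) = (‖g‖ ^ 2 * ‖c‖ ^ 2) • (1 : X d) := by
    rw [conj_mul, conj_i, conj_i, neg_mul_neg, mul_assoc, ← mul_assoc (i c), i_sq,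
      Algebra.smul_mul_assoc, one_mul, Algebra.mul_smul_comm, i_sq, smul_smul]
    congr 1
    ring
  rw [rotTrans, conj_smul, conj_mul, Algebra.smul_mul_assoc, Algebra.mul_smul_comm, smul_smul,
    mul_assoc, ← mul_assoc (i g * i c), h1, Algebra.smul_mul_assoc, one_mul, Algebra.mul_smul_comm,
    translation_mul_conj, smul_smul, ← pow_two, hk, one_smul]

/-- Reflection of `v` in the hyperplane orthogonal to `g`, scaled by `‖g‖²`. -/
noncomputable def scaledRefl (g v : EuclideanSpace ℝ (Fin d)) : EuclideanSpace ℝ (Fin d) :=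
  ‖g‖ ^ 2 • v - (2 * inner ℝ v g) • g

theorem scaledRefl_smul (g v : EuclideanSpace ℝ (Fin d)) (r : ℝ) :
    scaledRefl g (r • v) = r • scaledRefl g v := by
  simp only [scaledRefl, inner_smul_left, smul_sub, smul_smul]
  congr 2
  · ring
  · simp; ring

theorem scaledRefl_sub (g v w : EuclideanSpace ℝ (Fin d)) :
    scaledRefl g (v - w) = scaledRefl g v - scaledRefl g w := by
  simp only [scaledRefl, inner_sub_left, smul_sub, mul_sub, sub_smul]
  abel

theorem i_mul_pt_mul_conj_i (g v : EuclideanSpace ℝ (Fin d)) (hg : g ≠ 0) :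
    i g * pt v * conj d (i g) = (-‖g‖ ^ 2) • pt ((‖g‖ ^ 2)⁻¹ • scaledRefl g v) := by
  have hg' : ‖g‖ ^ 2 ≠ 0 := by simpa using hg
  rw [← neg_neg (i g * pt v * conj d (i g)), ← i_mul_pt_mul_i, pt, i_smul, Algebra.mul_smul_comm,
    smul_add, smul_smul, neg_mul, mul_inv_cancel₀ hg', neg_smul, neg_smul, one_smul, scaledRefl]
  abel

theorem rotTrans_mul_pt {k : ℝ} {g c : EuclideanSpace ℝ (Fin d)} (hg : g ≠ 0) (hc : c ≠ 0)
    (hk : k ^ 2 * (‖g‖ ^ 2 * ‖c‖ ^ 2) = 1) (x v : EuclideanSpace ℝ (Fin d)) :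
    rotTrans k g c x * pt v * conj d (rotTrans k g c x)
      = pt (k ^ 2 • scaledRefl g (scaledRefl c v) + (2 : ℝ) • x) := by
  have hg' : ‖g‖ ^ 2 ≠ 0 := by simpa using hg
  have hc' : ‖c‖ ^ 2 ≠ 0 := by simpa using hc
  have h1 : i g * i c * pt v * conj d (i g * i c)
      = (‖g‖ ^ 2 * ‖c‖ ^ 2) • pt (k ^ 2 • scaledRefl g (scaledRefl c v)) := by
    rw [conj_mul, show i g * i c * pt v * (conj d (i c) * conj d (i g))
      = i g * (i c * pt v * conj d (i c)) * conj d (i g) by simp only [mul_assoc],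
      i_mul_pt_mul_conj_i c v hc, Algebra.mul_smul_comm, Algebra.smul_mul_assoc,
      i_mul_pt_mul_conj_i g _ hg, smul_smul, scaledRefl_smul, smul_smul]
    congr 1
    · ring
    · congr 2
      field_simp
      linarith
  rw [rotTrans, conj_smul, conj_mul (1 + _), Algebra.smul_mul_assoc, Algebra.smul_mul_assoc,
    Algebra.mul_smul_comm, smul_smul,
    show ∀ A B C D E : X d, A * B * C * (D * E) = A * (B * C * D) * E from
      fun A B C D E => by simp only [mul_assoc], h1, Algebra.mul_smul_comm, Algebra.smul_mul_assoc,
    translation_mul_pt, smul_smul, ← pow_two, hk, one_smul]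

theorem scaledRefl_self (c : EuclideanSpace ℝ (Fin d)) : scaledRefl c c = -(‖c‖ ^ 2 • c) := by
  rw [scaledRefl, real_inner_self_eq_norm_sq, ← sub_smul, ← neg_smul]
  congr 1
  ring

theorem scaledRefl_add {c c' : EuclideanSpace ℝ (Fin d)} (h : ‖c‖ = ‖c'‖) :
    scaledRefl (c + c') c = -(‖c + c'‖ ^ 2 • c') := by
  have h1 : ‖c + c'‖ ^ 2 = 2 * inner ℝ c (c + c') := by
    rw [norm_add_sq_real, inner_add_right, real_inner_self_eq_norm_sq, ← h]
    ring
  rw [scaledRefl, ← h1, smul_add]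
  abel

theorem exists_mem_of_norm_eq {m : Type} [Fintype m] [DecidableEq m] [Nonempty m]
    (φ : X d →ₐ[ℝ] Matrix m m ℝ) (h0 : φ (eNil d) = 0) {a b p q : EuclideanSpace ℝ (Fin d)}
    (hab : a ≠ b) (hnorm : ‖a - b‖ = ‖p - q‖) (hne : a - b ≠ q - p) :
    ∃ z ∈ T a p ∩ T b q, (φ z).trace ≠ 0 := by
  obtain ⟨c, hcdef⟩ : ∃ c, c = a - b := ⟨_, rfl⟩
  obtain ⟨c', hcdef'⟩ : ∃ c', c' = p - q := ⟨_, rfl⟩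
  rw [← hcdef, ← hcdef'] at hnorm
  have hc : c ≠ 0 := hcdef ▸ sub_ne_zero.2 hab
  have hg : c + c' ≠ 0 := fun h => hne (by
    rw [← hcdef, eq_neg_of_add_eq_zero_left h, hcdef', neg_sub])
  have hg' : ‖c + c'‖ ≠ 0 := norm_ne_zero_iff.2 hg
  have hc' : ‖c‖ ≠ 0 := norm_ne_zero_iff.2 hc
  -- This `k` gives the product of the two vectors norm `N = 1`.
  obtain ⟨k, hkdef⟩ : ∃ k, k = (‖c + c'‖ * ‖c‖)⁻¹ := ⟨_, rfl⟩
  have hk0 : k ≠ 0 := hkdef ▸ inv_ne_zero (mul_ne_zero hg' hc')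
  have hk : k ^ 2 * (‖c + c'‖ ^ 2 * ‖c‖ ^ 2) = 1 := by
    rw [hkdef]; field_simp
  have hrot : k ^ 2 • scaledRefl (c + c') (scaledRefl c c) = c' := by
    rw [scaledRefl_self, ← neg_smul, scaledRefl_smul, scaledRefl_add hnorm, ← neg_smul, smul_smul,
      smul_smul, show k ^ 2 * -‖c‖ ^ 2 * -‖c + c'‖ ^ 2 = 1 by linarith, one_smul]
  -- The translation is fitted to `a ↦ p`; `b ↦ q` then follows because the rotation takes `c` to
  -- `c'`.
  obtain ⟨x, hx⟩ : ∃ x, k ^ 2 • scaledRefl (c + c') (scaledRefl c a) + (2 : ℝ) • x = p :=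
    ⟨(2⁻¹ : ℝ) • (p - k ^ 2 • scaledRefl (c + c') (scaledRefl c a)), by
      rw [smul_smul, mul_inv_cancel₀ two_ne_zero, one_smul]; abel⟩
  have hxb : k ^ 2 • scaledRefl (c + c') (scaledRefl c b) + (2 : ℝ) • x = q := by
    rw [show b = a - c by rw [hcdef]; abel, scaledRefl_sub, scaledRefl_sub, smul_sub, hrot,
      sub_add_eq_add_sub, hx, hcdef']
    abel
  have hact := rotTrans_mul_pt hg hc hk x
  have hspun : rotTrans k (c + c') c x ∈ Spun d :=
    ⟨rotTrans_mem_Z0 _ _ _ _, rotTrans_mul_conj hk x, fun v => ⟨_, hact v⟩⟩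
  refine ⟨rotTrans k (c + c') c x, ⟨⟨hspun, ?_⟩, hspun, ?_⟩, ?_⟩
  · rw [hact, hx]
  · rw [hact, hxb]
  · have h1 : φ (rotTrans k (c + c') c x) = k • φ (i (c + c') * i c) := by
      simp [rotTrans, h0]
    -- Equality of norms makes the inner product half of a nonzero square, so the trace cannot
    -- vanish.
    have h2 : ‖c + c'‖ ^ 2 = 2 * inner ℝ (c + c') c := by
      rw [norm_add_sq_real, inner_add_left, real_inner_self_eq_norm_sq, ← hnorm,
        real_inner_comm c c']
      ring
    have h3 : (inner ℝ (c + c') c : ℝ) ≠ 0 := by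
      intro h
      rw [h, mul_zero] at h2
      exact hg' (by simpa using h2)
    rw [h1, Matrix.trace_smul, trace_map_i_mul_i, smul_eq_mul, Matrix.trace_one]
    exact mul_ne_zero hk0 (mul_ne_zero (neg_ne_zero.2 h3) (by simp))

end SpunGroup

theorem lemma5p12 (d : ℕ) (a b p q : EuclideanSpace ℝ (Fin d)) (hab : a ≠ b)
    (hne : (SpunGroup.T a p ∩ SpunGroup.T b q).Nonempty) :
    SpunGroup.T a p ∩ SpunGroup.T b q ⊆ (SpunGroup.H0 d : Set (SpunGroup.X d)) ↔
      a - b = q - p := by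
  obtain ⟨m, _, _, _, φ, δ, h0, h1, h2⟩ := SpunGroup.exists_representation d
  have key : ∀ z ∈ SpunGroup.T a p ∩ SpunGroup.T b q,
      φ z * φ (SpunGroup.conj d z) = 1 ∧
      φ z * φ (SpunGroup.i (a - b)) * φ (SpunGroup.conj d z) = φ (SpunGroup.i (p - q)) := by
    rintro z ⟨⟨hz, ha⟩, -, hb⟩
    refine ⟨by rw [← map_mul, hz.2.1, map_one], ?_⟩
    refine SpunGroup.map_mul_i_mul_conj φ δ h0 h1 h2 ?_
    rw [← SpunGroup.pt_sub_pt, ← SpunGroup.pt_sub_pt, mul_sub, sub_mul, ha, hb]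
  constructor
  · intro hsub
    by_contra h
    -- The given common element serves only to supply `‖a - b‖ = ‖p - q‖`; the contradiction comes
    -- from the constructed `w`.
    obtain ⟨z, hz⟩ := hne
    obtain ⟨hz1, hz2⟩ := key z hz
    obtain ⟨w, hw, hw'⟩ := SpunGroup.exists_mem_of_norm_eq φ h0 hab
      (SpunGroup.norm_eq_of_conj φ hz1 hz2) h
    exact hw' (SpunGroup.trace_map_eq_zero_of_mem_H0 φ (hsub hw))
  · intro h z hz
    obtain ⟨hz1, hz2⟩ := key z hz
    refine SpunGroup.mem_H0_of_trace_map_eq_zero φ hz.1.1.1 ?_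
    refine SpunGroup.trace_eq_zero_of_conj_neg φ hz1 (sub_ne_zero.2 hab) ?_
    rwa [h, neg_sub, ← h]
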